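/- Let $q\ge 4$ be a prime power and let $\mathcal C$ be an ovoid code over $\mathrm{GF}(q)$, that is, a linear $[q^2+1,4,q^2-q]$ code over $\mathrm{GF}(q)$ (length, dimension, minimum Hamming distance). For a linear code $\mathcal D$, let $\mathcal D^\perp$ be its dual with respect to the standard inner product, let $A_k(\mathcal D)$ be the number of codewords of Hamming weight $k$, and call $\sum_k A_k(\mathcal D)z^k$ the weight enumerator of $\mathcal D$. For a coordinate $t_1$, the shortened code $\mathcal D_{\{t_1\}}$ consists of the codewords of $\mathcal D$ that are $0$ at $t_1$, with the coordinate $t_1$ deleted. An $[n,\kappa,d]$ code is almost MDS if $d=n-\kappa$. Then for every coordinate $t_1$ of $\mathcal C$ the following hold. 1. $\mathcal C_{\{t_1\}}$ is a $[q^2,3,q^2-q]$ code with weight enumerator $$1+q(q^2-1)z^{q^2-q}+(q-1)z^{q^2}.$$ 2. $(\mathcal C_{\{t_1\}})^\perp$ is a $[q^2,q^2-3,3]$ almost MDS code. 3. $((\mathcal C^\perp)_{\{t_1\}})^\perp$ is a $[q^2,4,q^2-q-1]$ code with weight enumerator $$1+q^2(q-1)^2z^{q^2-q-1}+q(q^2-1)z^{q^2-q}+q^2(q-1)z^{q^2-1}+(q-1)z^{q^2}.$$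 4. $(\mathcal C^\perp)_{\{t_1\}}$ is a $[q^2,q^2-4,4]$ almost MDS code, and for $1\le k\le q^2$, $$A_k\big((\mathcal C^\perp)_{\{t_1\}}\big)=\frac{\binom{k}{1}\binom{q^2}{k}}{\binom{q^2+1}{1}\binom{q^2}{k-1}}\,A_k(\mathcal C^\perp),$$ where $A_1(\mathcal C^\perp)=A_2(\mathcal C^\perp)=A_3(\mathcal C^\perp)=0$ and, for $4\le k\le q^2$, with $u=(q^2-q)(q^2+1)$ and $v=(q-1)(q^2+1)$, $$q^4A_k(\mathcal C^\perp)=\binom{q^2+1}{k}(q-1)^k+u\sum_{i+j=k}\binom{q^2-q}{i}(-1)^i\binom{q+1}{j}(q-1)^j+v\left[(-1)^k\binom{q^2}{k}+(-1)^{k-1}(q-1)\binom{q^2}{k-1}\right].$$ -/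

import Mathlib

open Polynomial

namespace LinearCode

variable {F : Type*} [Field F] {ι : Type*}

/-- The dual code `C^⊥` with respect to the standard bilinear form `x ⬝ᵥ y = ∑ i, x i * y i`. -/
def dual [Fintype ι] (C : Submodule F (ι → F)) : Submodule F (ι → F) :=
  C.orthogonalBilin (dotProductBilin F F)

theorem mem_dual [Fintype ι] (C : Submodule F (ι → F)) (v : ι → F) :
    v ∈ dual C ↔ ∀ c ∈ C, c ⬝ᵥ v = 0 :=
  Iff.rfl

/-- The punctured code `C^T`: delete the coordinates in `T` from every codeword. -/
def punctured (C : Submodule F (ι → F)) (T : Finset ι) : Submodule F ({i // i ∉ T} → F) :=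
  C.map (LinearMap.funLeft F F (Subtype.val : {i // i ∉ T} → ι))

/-- The subcode `C(T)` of the codewords of `C` that are `0` on `T`. -/
def vanishingOn (C : Submodule F (ι → F)) (T : Finset ι) : Submodule F (ι → F) where
  carrier := {c | c ∈ C ∧ ∀ i ∈ T, c i = 0}
  add_mem' := fun ha hb =>
    ⟨C.add_mem ha.1 hb.1, fun i hi => by simp [ha.2 i hi, hb.2 i hi]⟩
  zero_mem' := ⟨C.zero_mem, fun _ _ => rfl⟩
  smul_mem' := fun r _ ha => ⟨C.smul_mem r ha.1, fun i hi => by simp [ha.2 i hi]⟩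

/-- The shortened code `C_T`: puncture the subcode `C(T)` on `T`. -/
def shortened (C : Submodule F (ι → F)) (T : Finset ι) : Submodule F ({i // i ∉ T} → F) :=
  punctured (vanishingOn C T) T

/-- `d` is the minimum distance of `C`: the least Hamming distance between distinct codewords.
(No `d` has this property when `C` is the zero code.) -/
def IsMinDist [Fintype ι] [DecidableEq F] (C : Submodule F (ι → F)) (d : ℕ) : Prop :=
  IsLeast {m | ∃ x ∈ C, ∃ y ∈ C, x ≠ y ∧ hammingDist x y = m} d

/-- `C` is an `[n, k, d]` code over `F`. -/
structure HasParams [Fintype ι] [DecidableEq F] (C : Submodule F (ι → F)) (n k d : ℕ) :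
    Prop where
  length_eq : Fintype.card ι = n
  dim_eq : Module.finrank F C = k
  minDist_eq : IsMinDist C d

/-- An almost MDS code: the parameters are `[n, k, n - k]`, i.e. `d = n - k`. -/
def IsAlmostMDS [Fintype ι] [DecidableEq F] (C : Submodule F (ι → F)) : Prop :=
  ∃ n k d : ℕ, HasParams C n k d ∧ d + k = n

/-- `A_w(C)`: the number of codewords of Hamming weight `w` in `C`. -/
noncomputable def weightCount [Fintype ι] [DecidableEq F] (C : Submodule F (ι → F))
    (w : ℕ) : ℕ :=
  Set.ncard {c : ι → F | c ∈ C ∧ hammingNorm c = w}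

/-- The weight enumerator `∑_{i = 0}^{n} A_i(C) z^i`, where `n` is the length of `C`. -/
noncomputable def weightEnumerator [Fintype ι] [DecidableEq F] (C : Submodule F (ι → F)) :
    ℤ[X] :=
  ∑ i ∈ Finset.range (Fintype.card ι + 1), (weightCount C i : ℤ[X]) * X ^ i

end LinearCode

/-! A nonzero word of `C` corresponds to a plane section of the ovoid, and the distance `q ^ 2 - q`
says that such a section has at most `q + 1` points. Counting zeros shows that any three coordinates
are independent (`finrank_vanishingOn_of_card_eq_three`). Hence the first three factorial moments of
the number of zeros are known, and nonzero dual words have weight at least 4. Summing the cubic `(q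
+ 1 - z) * (z - 1) ^ 2` over all words then forces `z = 1` or `z = q + 1` for every nonzero word
(`card_zeroSet_eq`).

With only two possible weights, the size and the total number of zeros of a set of words determine
its weight distribution. Applied to the words that vanish at `t₁` and to those that do not, this
gives both weight enumerators: shortening keeps the first set, while puncturing also keeps the
second with weights lowered by one. The dual statements use that shortening the dual is dualizing
the punctured code (`shortened_dual`).

The MacWilliams identity gives the weights of `dual C`. Applied to the punctured code, whose weights
do not depend on the coordinate, it shows that all shortenings of `dual C` at one coordinate have
the same weight distribution; double counting zeros then gives the ratio in the last item. -/

namespace LinearCode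

/-! ### Duality for the standard bilinear form. -/

section Duality

variable {F : Type*} [Field F] {ι : Type*} [Fintype ι]

theorem dotProductBilin_nondegenerate [DecidableEq ι] :
    LinearMap.BilinForm.Nondegenerate (dotProductBilin F F : LinearMap.BilinForm F (ι → F)) := by
  constructor
  · intro x hx
    funext i
    simpa [dotProductBilin] using hx (Pi.single i 1)
  · intro x hx
    funext i
    simpa [dotProductBilin] using hx (Pi.single i 1)

theorem dual_dual [DecidableEq ι] (C : Submodule F (ι → F)) : dual (dual C) = C := by
  refine LinearMap.BilinForm.orthogonal_orthogonal dotProductBilin_nondegenerate ?_ C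
  intro x y h
  rw [← h]
  exact dotProduct_comm _ _

theorem finrank_dual [DecidableEq ι] (C : Submodule F (ι → F)) :
    Module.finrank F (dual C) = Fintype.card ι - Module.finrank F C := by
  rw [← Module.finrank_pi F (ι := ι)]
  exact LinearMap.BilinForm.finrank_orthogonal dotProductBilin_nondegenerate C

theorem dual_sup (C D : Submodule F (ι → F)) : dual (C ⊔ D) = dual C ⊓ dual D := by
  ext v
  simp only [Submodule.mem_inf, mem_dual]
  constructor
  · exact fun h => ⟨fun c hc => h c (Submodule.mem_sup_left hc),
      fun c hc => h c (Submodule.mem_sup_right hc)⟩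
  · rintro ⟨h₁, h₂⟩ c hc
    obtain ⟨x, hx, y, hy, rfl⟩ := Submodule.mem_sup.1 hc
    rw [add_dotProduct, h₁ x hx, h₂ y hy, add_zero]

end Duality

/-! ### Subcodes vanishing on a set, and shortening versus puncturing. -/

section Vanishing

variable {F : Type*} [Field F] {ι : Type*}

theorem mem_vanishingOn {C : Submodule F (ι → F)} {T : Finset ι} {c : ι → F} :
    c ∈ vanishingOn C T ↔ c ∈ C ∧ ∀ i ∈ T, c i = 0 :=
  Iff.rfl

theorem vanishingOn_eq_inf (C : Submodule F (ι → F)) (T : Finset ι) :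
    vanishingOn C T = C ⊓ vanishingOn ⊤ T := by
  ext c
  simp [mem_vanishingOn]

theorem vanishingOn_vanishingOn [DecidableEq ι] (C : Submodule F (ι → F)) (S T : Finset ι) :
    vanishingOn (vanishingOn C S) T = vanishingOn C (S ∪ T) := by
  ext c
  simp only [mem_vanishingOn, Finset.mem_union]
  grind

theorem vanishingOn_anti (C : Submodule F (ι → F)) {S T : Finset ι} (h : S ⊆ T) :
    vanishingOn C T ≤ vanishingOn C S :=
  fun _ hc => ⟨hc.1, fun i hi => hc.2 i (h hi)⟩

theorem finrank_vanishingOn_top [Fintype ι] (T : Finset ι) :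
    Module.finrank F (vanishingOn (⊤ : Submodule F (ι → F)) T) + T.card = Fintype.card ι := by
  have hker : vanishingOn (⊤ : Submodule F (ι → F)) T =
      LinearMap.ker (LinearMap.funLeft F F (Subtype.val : T → ι)) := by
    ext c
    simp only [mem_vanishingOn, Submodule.mem_top, true_and, LinearMap.mem_ker]
    constructor
    · exact fun h => funext fun i => h i i.2
    · exact fun h i hi => congrFun h ⟨i, hi⟩
  have hrank := LinearMap.finrank_range_add_finrank_ker
    (LinearMap.funLeft F F (Subtype.val : T → ι))
  rw [LinearMap.range_eq_top.2
    (LinearMap.funLeft_surjective_of_injective F F _ Subtype.val_injective), finrank_top,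
    Module.finrank_pi, Module.finrank_pi, Fintype.card_coe] at hrank
  rw [hker]
  omega

theorem dual_vanishingOn_top [Fintype ι] [DecidableEq ι] (T : Finset ι) :
    dual (vanishingOn (⊤ : Submodule F (ι → F)) T) = vanishingOn ⊤ Tᶜ := by
  ext v
  simp only [mem_dual, mem_vanishingOn, Submodule.mem_top, true_and, Finset.mem_compl]
  constructor
  · intro h i hi
    simpa using h (Pi.single i 1) fun j hj => by
      rw [Pi.single_apply, if_neg]
      rintro rfl
      exact hi hj
  · intro h c hc
    refine Finset.sum_eq_zero fun i _ => ?_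
    by_cases hi : i ∈ T
    · rw [hc i hi, zero_mul]
    · rw [h i hi, mul_zero]

/-- The local form of MacWilliams duality: the dual words supported on `T` against the words
vanishing on `T`. -/
theorem finrank_vanishingOn_dual_compl [Fintype ι] [DecidableEq ι] (C : Submodule F (ι → F))
    (T : Finset ι) :
    Module.finrank F (vanishingOn (dual C) Tᶜ) + Module.finrank F C =
      T.card + Module.finrank F (vanishingOn C T) := by
  -- Being supported on `T` means being orthogonal to all words vanishing on `T`, so the dimension
  -- formula for a sum and an intersection finishes the count.
  have h₁ : vanishingOn (dual C) Tᶜ = dual (C ⊔ vanishingOn ⊤ T) := by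
    rw [dual_sup, dual_vanishingOn_top, ← vanishingOn_eq_inf]
  have h₂ := Submodule.finrank_sup_add_finrank_inf_eq C (vanishingOn ⊤ T)
  have h₃ := finrank_vanishingOn_top (F := F) T
  have h₄ := (C ⊔ vanishingOn ⊤ T).finrank_le
  rw [Module.finrank_pi] at h₄
  rw [h₁, finrank_dual, vanishingOn_eq_inf C T]
  omega

theorem finrank_le_card_add_finrank_vanishingOn [Fintype ι] [DecidableEq ι]
    (C : Submodule F (ι → F)) (T : Finset ι) :
    Module.finrank F C ≤ T.card + Module.finrank F (vanishingOn C T) := by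
  have := finrank_vanishingOn_dual_compl C T
  omega

theorem restrict_injOn_vanishingOn (C : Submodule F (ι → F)) (T : Finset ι) :
    Set.InjOn (fun (c : ι → F) (i : {i // i ∉ T}) => c i) (vanishingOn C T : Set (ι → F)) := by
  intro c hc d hd h
  funext i
  by_cases hi : i ∈ T
  · rw [hc.2 i hi, hd.2 i hi]
  · exact congrFun h ⟨i, hi⟩

theorem finrank_punctured {C : Submodule F (ι → F)} {T : Finset ι}
    (h : Set.InjOn (fun (c : ι → F) (i : {i // i ∉ T}) => c i) (C : Set (ι → F))) :
    Module.finrank F (punctured C T) = Module.finrank F C := by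
  let f := (LinearMap.funLeft F F (Subtype.val : {i // i ∉ T} → ι)).domRestrict C
  have hf : Function.Injective f := fun x y hxy => Subtype.ext (h x.2 y.2 hxy)
  have hr : LinearMap.range f = punctured C T := by
    rw [LinearMap.range_domRestrict]
    rfl
  rw [← hr, LinearMap.finrank_range_of_inj hf]

theorem finrank_shortened (C : Submodule F (ι → F)) (T : Finset ι) :
    Module.finrank F (shortened C T) = Module.finrank F (vanishingOn C T) :=
  finrank_punctured (restrict_injOn_vanishingOn C T)

/-- Extension by zero on `T` does not change dot products, so a word off `T` is orthogonal to the
punctured code exactly when its extension is orthogonal to `C`. -/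
theorem shortened_dual [Fintype ι] [DecidableEq ι] (C : Submodule F (ι → F)) (T : Finset ι) :
    shortened (dual C) T = dual (punctured C T) := by
  have key : ∀ c v : ι → F, (∀ i ∈ T, v i = 0) →
      (fun i : {i // i ∉ T} => c i) ⬝ᵥ (fun i : {i // i ∉ T} => v i) = c ⬝ᵥ v := by
    intro c v hv
    simp only [dotProduct]
    rw [← Finset.sum_subtype (Finset.univ.filter (· ∉ T)) (by simp) (fun i => c i * v i)]
    refine Finset.sum_filter_of_ne fun i _ hne hi => hne ?_
    rw [hv i hi, mul_zero]
  ext x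
  constructor
  · rintro ⟨v, ⟨hv, hT⟩, rfl⟩ _ ⟨c, hc, rfl⟩
    exact (key c v hT).trans (hv c hc)
  · intro hx
    have hx' : ∀ i ∈ T, (fun i => if h : i ∈ T then 0 else x ⟨i, h⟩ : ι → F) i = 0 :=
      fun i hi => dif_pos hi
    have hr : (fun i : {i // i ∉ T} =>
        (fun i => if h : i ∈ T then 0 else x ⟨i, h⟩ : ι → F) i) = x :=
      funext fun i => dif_neg i.2
    refine ⟨_, ⟨fun c hc => ?_, hx'⟩, hr⟩
    have := key c _ hx'
    rw [hr] at this
    exact this.symm.trans (hx _ ⟨c, hc, rfl⟩)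

theorem dual_shortened_dual [Fintype ι] [DecidableEq ι] (C : Submodule F (ι → F))
    (T : Finset ι) : dual (shortened (dual C) T) = punctured C T := by
  rw [shortened_dual, dual_dual]

end Vanishing

/-! ### Hamming weight, zero sets and minimum distance. -/

section Weight

variable {F : Type*} [Field F] [DecidableEq F] {ι : Type*} [Fintype ι]

/-- The coordinates at which `c` vanishes. -/
def zeroSet (c : ι → F) : Finset ι :=
  Finset.univ.filter (c · = 0)

theorem mem_zeroSet {c : ι → F} {i : ι} : i ∈ zeroSet c ↔ c i = 0 := by
  simp [zeroSet]

theorem card_zeroSet_add_hammingNorm (c : ι → F) :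
    (zeroSet c).card + hammingNorm c = Fintype.card ι := by
  rw [zeroSet, hammingNorm, Finset.card_filter_add_card_filter_not, Finset.card_univ]

theorem hammingNorm_eq_sub_card_zeroSet (c : ι → F) :
    hammingNorm c = Fintype.card ι - (zeroSet c).card := by
  have := card_zeroSet_add_hammingNorm c
  omega

theorem isMinDist_of_forall_le {C : Submodule F (ι → F)} {d : ℕ}
    (hle : ∀ c ∈ C, c ≠ 0 → d ≤ hammingNorm c) (hex : ∃ c ∈ C, c ≠ 0 ∧ hammingNorm c ≤ d) :
    IsMinDist C d := by
  constructor
  · obtain ⟨c, hc, h0, hd⟩ := hex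
    exact ⟨c, hc, 0, C.zero_mem, h0, by
      rw [hammingDist_zero_right]; exact le_antisymm hd (hle c hc h0)⟩
  · rintro m ⟨x, hx, y, hy, hxy, rfl⟩
    rw [hammingDist_eq_hammingNorm]
    exact hle _ (C.add_mem (C.neg_mem hx) hy) fun h => hxy (neg_add_eq_zero.1 h)

theorem IsMinDist.le_hammingNorm {C : Submodule F (ι → F)} {d : ℕ} (h : IsMinDist C d)
    {c : ι → F} (hc : c ∈ C) (h0 : c ≠ 0) : d ≤ hammingNorm c :=
  h.2 ⟨c, hc, 0, C.zero_mem, h0, hammingDist_zero_right c⟩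

theorem hammingNorm_restrict_singleton [DecidableEq ι] (c : ι → F) (t : ι) :
    hammingNorm (fun i : {i // i ∉ ({t} : Finset ι)} => c i) + (if c t = 0 then 0 else 1) =
      hammingNorm c := by
  simp only [hammingNorm]
  have h₁ : (Finset.univ.filter fun i : {i // i ∉ ({t} : Finset ι)} => c i ≠ 0).card =
      ((Finset.univ.filter (c · ≠ 0)).erase t).card := by
    rw [← Finset.card_map (Function.Embedding.subtype _)]
    congr 1
    ext i
    simp
    tauto
  rw [h₁]
  split_ifs with h
  · rw [Finset.erase_eq_of_notMem (by simpa using h), add_zero]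
  · exact Finset.card_erase_add_one (by simpa using h)

theorem card_subtype_notMem_singleton [DecidableEq ι] (t : ι) :
    Fintype.card {i // i ∉ ({t} : Finset ι)} + 1 = Fintype.card ι := by
  have := Fintype.card_pos_iff.2 ⟨t⟩
  simp only [Fintype.card_subtype_compl, Fintype.card_coe, Finset.card_singleton]
  omega

/-- A nonzero codeword that vanishes on `finrank C` coordinates yields a nonzero dual word
supported on these coordinates. -/
theorem exists_dual_hammingNorm_le [DecidableEq ι] {C : Submodule F (ι → F)} {k : ℕ}
    (hk : Module.finrank F C ≤ k) {c : ι → F} (hc : c ∈ C) (h0 : c ≠ 0)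
    (hz : k ≤ (zeroSet c).card) : ∃ d ∈ dual C, d ≠ 0 ∧ hammingNorm d ≤ k := by
  obtain ⟨T, hT, hTk⟩ := Finset.exists_subset_card_eq hz
  have hkey := finrank_vanishingOn_dual_compl C T
  have hpos : 0 < Module.finrank F (vanishingOn C T) :=
    Module.finrank_pos_iff_exists_ne_zero.2
      ⟨⟨c, hc, fun i hi => mem_zeroSet.1 (hT hi)⟩, fun h => h0 (congrArg Subtype.val h)⟩
  have hpos' : 0 < Module.finrank F (vanishingOn (dual C) Tᶜ) := by omega
  obtain ⟨⟨d, hd, hdT⟩, hd0⟩ := Module.finrank_pos_iff_exists_ne_zero.1 hpos'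
  refine ⟨d, hd, fun h => hd0 (Subtype.ext h), ?_⟩
  have hsub : Tᶜ ⊆ zeroSet d := fun i hi => mem_zeroSet.2 (hdT i hi)
  have h₁ := Finset.card_le_card hsub
  have h₂ := card_zeroSet_add_hammingNorm d
  rw [Finset.card_compl] at h₁
  omega

/-- If the restriction of `C` to every `k` coordinates is onto, every nonzero dual word has
weight more than `k`. -/
theorem lt_hammingNorm_of_mem_dual [DecidableEq ι] {C : Submodule F (ι → F)} {k : ℕ}
    (hC : ∀ T : Finset ι, T.card ≤ k →
      T.card + Module.finrank F (vanishingOn C T) = Module.finrank F C)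
    {d : ι → F} (hd : d ∈ dual C) (h0 : d ≠ 0) : k < hammingNorm d := by
  by_contra! hlt
  have h₁ := card_zeroSet_add_hammingNorm d
  have hcard : (zeroSet d)ᶜ.card ≤ k := by
    rw [Finset.card_compl]
    omega
  have hkey := finrank_vanishingOn_dual_compl C (zeroSet d)ᶜ
  rw [hC _ hcard, compl_compl] at hkey
  have hpos : 0 < Module.finrank F (vanishingOn (dual C) (zeroSet d)) :=
    Module.finrank_pos_iff_exists_ne_zero.2
      ⟨⟨d, hd, fun i hi => mem_zeroSet.1 hi⟩, fun h => h0 (congrArg Subtype.val h)⟩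
  omega

end Weight

/-! ### Sums over codewords. -/

section Codewords

variable {F : Type*} [Field F] [Fintype F] {ι : Type*} [Fintype ι]

/-- The codewords of `C` as a `Finset`. -/
noncomputable def codewords (C : Submodule F (ι → F)) : Finset (ι → F) :=
  (Set.toFinite (C : Set (ι → F))).toFinset

@[simp]
theorem mem_codewords {C : Submodule F (ι → F)} {c : ι → F} : c ∈ codewords C ↔ c ∈ C := by
  simp [codewords]

theorem card_codewords (C : Submodule F (ι → F)) :
    (codewords C).card = Fintype.card F ^ Module.finrank F C := by
  rw [← Nat.card_eq_fintype_card, ← Module.natCard_eq_pow_finrank, codewords,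
    ← Set.ncard_eq_toFinset_card]
  rfl

theorem sum_codewords_punctured [DecidableEq ι] {M : Type*} [AddCommMonoid M] {C : Submodule F (ι → F)} {T : Finset ι}
    (h : Set.InjOn (fun (c : ι → F) (i : {i // i ∉ T}) => c i) (C : Set (ι → F)))
    (g : ({i // i ∉ T} → F) → M) :
    ∑ x ∈ codewords (punctured C T), g x = ∑ c ∈ codewords C, g fun i => c i := by
  symm
  refine Finset.sum_bij (fun c _ i => c i) ?_ ?_ ?_ fun _ _ => rfl
  · exact fun c hc => mem_codewords.2 ⟨c, mem_codewords.1 hc, rfl⟩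
  · exact fun c hc d hd hcd => h (mem_codewords.1 hc) (mem_codewords.1 hd) hcd
  · intro x hx
    obtain ⟨c, hc, rfl⟩ := mem_codewords.1 hx
    exact ⟨c, mem_codewords.2 hc, rfl⟩

variable [DecidableEq F]

theorem codewords_vanishingOn [DecidableEq ι] (C : Submodule F (ι → F)) (T : Finset ι) :
    codewords (vanishingOn C T) = (codewords C).filter (T ⊆ zeroSet ·) := by
  ext c
  simp [mem_vanishingOn, Finset.subset_iff, mem_zeroSet]

theorem codewords_vanishingOn_singleton (C : Submodule F (ι → F)) (t : ι) :
    codewords (vanishingOn C {t}) = (codewords C).filter (· t = 0) := by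
  ext c
  simp [mem_vanishingOn]

theorem weightCount_eq_card (C : Submodule F (ι → F)) (w : ℕ) :
    weightCount C w = ((codewords C).filter (hammingNorm · = w)).card := by
  rw [weightCount, ← Set.ncard_coe_finset]
  congr 1
  ext c
  simp

theorem weightEnumerator_eq_sum (C : Submodule F (ι → F)) :
    weightEnumerator C = ∑ c ∈ codewords C, (X : ℤ[X]) ^ hammingNorm c := by
  rw [weightEnumerator, ← Finset.sum_fiberwise_of_maps_to (s := codewords C)
    (t := Finset.range (Fintype.card ι + 1)) (g := fun c => hammingNorm c)]
  · refine Finset.sum_congr rfl fun w _ => ?_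
    rw [Finset.sum_congr rfl fun c hc => by rw [(Finset.mem_filter.1 hc).2], Finset.sum_const,
      nsmul_eq_mul, weightCount_eq_card]
  · exact fun c _ => Finset.mem_range_succ_iff.2 hammingNorm_le_card_fintype

theorem coeff_weightEnumerator (C : Submodule F (ι → F)) (w : ℕ) :
    (weightEnumerator C).coeff w = weightCount C w := by
  rw [weightEnumerator_eq_sum, finsetSum_coeff, weightCount_eq_card, Finset.card_filter]
  push_cast
  exact Finset.sum_congr rfl fun c _ => by simp [coeff_X_pow, eq_comm]

/-- The factorial moments of the number of zeros of a codeword. -/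
theorem sum_card_zeroSet_choose [DecidableEq ι] (C : Submodule F (ι → F)) (j : ℕ) :
    ∑ c ∈ codewords C, (zeroSet c).card.choose j =
      ∑ T ∈ Finset.univ.powersetCard j, (codewords (vanishingOn C T)).card := by
  simp_rw [codewords_vanishingOn, Finset.card_filter]
  rw [Finset.sum_comm]
  refine Finset.sum_congr rfl fun c _ => ?_
  rw [← Finset.card_powersetCard, ← Finset.card_filter]
  congr 1
  ext T
  simp [Finset.mem_powersetCard, and_comm]

theorem sum_card_zeroSet [DecidableEq ι] (C : Submodule F (ι → F)) :
    ∑ c ∈ codewords C, (zeroSet c).card = ∑ i, (codewords (vanishingOn C {i})).card := by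
  have := sum_card_zeroSet_choose C 1
  rw [Finset.powersetCard_one, Finset.sum_map] at this
  simpa using this

/-! ### The MacWilliams identity. -/

section MacWilliams

variable [DecidableEq ι] {R : Type*} [CommRing R]

/-- Expand `(a + b)` to the number of zeros of `c` as a sum over the subsets of `zeroSet c`, then
exchange the two sums. -/
theorem sum_card_vanishingOn_mul (C : Submodule F (ι → F)) (a b : R) :
    ∑ T : Finset ι, a ^ T.card * b ^ Tᶜ.card * ((codewords (vanishingOn C T)).card : R) =
      ∑ c ∈ codewords C, b ^ hammingNorm c * (a + b) ^ (Fintype.card ι - hammingNorm c) := by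
  simp_rw [codewords_vanishingOn, Finset.card_filter, Nat.cast_sum, Finset.mul_sum]
  rw [Finset.sum_comm]
  refine Finset.sum_congr rfl fun c _ => ?_
  have hz := card_zeroSet_add_hammingNorm c
  have hz' : Fintype.card ι - hammingNorm c = (zeroSet c).card := by omega
  rw [hz', ← Finset.sum_pow_mul_eq_add_pow, Finset.mul_sum]
  have hp : (zeroSet c).powerset = Finset.univ.filter (· ⊆ zeroSet c) := by
    ext T
    simp
  rw [hp, Finset.sum_filter]
  refine Finset.sum_congr rfl fun T _ => ?_
  split_ifs with hT
  · have hle := Finset.card_le_card hT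
    have hc : Tᶜ.card = hammingNorm c + ((zeroSet c).card - T.card) := by
      rw [Finset.card_compl]
      omega
    rw [hc, pow_add]
    push_cast
    ring
  · simp

theorem sum_card_vanishingOn_compl_mul (C : Submodule F (ι → F)) (a b : R) :
    ∑ T : Finset ι, a ^ T.card * b ^ Tᶜ.card * ((codewords (vanishingOn C Tᶜ)).card : R) =
      ∑ c ∈ codewords C, a ^ hammingNorm c * (a + b) ^ (Fintype.card ι - hammingNorm c) := by
  rw [add_comm a b, ← sum_card_vanishingOn_mul C b a]
  refine Fintype.sum_equiv (Equiv.ofBijective _ compl_bijective) _ _ fun T => ?_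
  simp [mul_comm]

/-- The MacWilliams identity. -/
theorem card_pow_finrank_mul_weightEnumerator_dual (C : Submodule F (ι → F)) :
    (Fintype.card F : ℤ[X]) ^ Module.finrank F C * weightEnumerator (dual C) =
      ∑ c ∈ codewords C, (1 - X) ^ hammingNorm c *
        (1 + ((Fintype.card F : ℤ[X]) - 1) * X) ^ (Fintype.card ι - hammingNorm c) := by
  -- The choice `a + b = 1` leaves the bare weight enumerator of the dual. The factor `q` in the
  -- next `a` absorbs the `q ^ T.card` of the local duality, so the two sums agree term by term.
  have h₁ := sum_card_vanishingOn_compl_mul (dual C) (X : ℤ[X]) (1 - X)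
  have h₂ := sum_card_vanishingOn_mul C ((Fintype.card F : ℤ[X]) * X) (1 - X)
  rw [show (Fintype.card F : ℤ[X]) * X + (1 - X) = 1 + ((Fintype.card F : ℤ[X]) - 1) * X by
    ring] at h₂
  simp only [add_sub_cancel, one_pow, mul_one] at h₁
  rw [weightEnumerator_eq_sum, ← h₁, ← h₂, Finset.mul_sum]
  refine Finset.sum_congr rfl fun T _ => ?_
  have h₃ : (Fintype.card F : ℤ[X]) ^ Module.finrank F C *
      ((codewords (vanishingOn (dual C) Tᶜ)).card : ℤ[X]) =
      (Fintype.card F : ℤ[X]) ^ T.card * ((codewords (vanishingOn C T)).card : ℤ[X]) := by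
    rw [card_codewords, card_codewords]
    push_cast
    rw [← pow_add, ← pow_add, ← finrank_vanishingOn_dual_compl, add_comm]
  linear_combination (X ^ T.card * (1 - X) ^ Tᶜ.card) * h₃

end MacWilliams

/-! ### Deleting one coordinate. -/

section Deletion

variable [DecidableEq ι] {M : Type*} [AddCommMonoid M]

/-- The function `f` is arbitrary so that one formula serves for indicators of a weight, for powers
of `X` and for MacWilliams summands. -/
theorem sum_codewords_shortened_singleton (C : Submodule F (ι → F)) (t : ι) (f : ℕ → M) :
    ∑ x ∈ codewords (shortened C {t}), f (hammingNorm x) =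
      ∑ c ∈ codewords C with c t = 0, f (hammingNorm c) := by
  rw [shortened, sum_codewords_punctured (restrict_injOn_vanishingOn C {t}),
    codewords_vanishingOn_singleton]
  refine Finset.sum_congr rfl fun c hc => ?_
  rw [← hammingNorm_restrict_singleton c t, if_pos (Finset.mem_filter.1 hc).2, add_zero]

theorem sum_codewords_punctured_singleton {C : Submodule F (ι → F)} {t : ι}
    (h : Set.InjOn (fun (c : ι → F) (i : {i // i ∉ ({t} : Finset ι)}) => c i)
      (C : Set (ι → F))) (f : ℕ → M) :
    ∑ x ∈ codewords (punctured C {t}), f (hammingNorm x) =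
      ∑ c ∈ codewords C with c t = 0, f (hammingNorm c) +
        ∑ c ∈ codewords C with c t ≠ 0, f (hammingNorm c - 1) := by
  rw [sum_codewords_punctured h, ← Finset.sum_filter_add_sum_filter_not _ (fun c => c t = 0)]
  congr 1
  · refine Finset.sum_congr rfl fun c hc => ?_
    rw [← hammingNorm_restrict_singleton c t, if_pos (Finset.mem_filter.1 hc).2, add_zero]
  · refine Finset.sum_congr rfl fun c hc => ?_
    rw [← hammingNorm_restrict_singleton c t, if_neg (Finset.mem_filter.1 hc).2,
      Nat.add_sub_cancel]

theorem weightCount_shortened_singleton (C : Submodule F (ι → F)) (t : ι) (w : ℕ) :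
    weightCount (shortened C {t}) w =
      ((codewords C).filter fun c => hammingNorm c = w ∧ c t = 0).card := by
  rw [weightCount_eq_card, Finset.card_filter,
    sum_codewords_shortened_singleton C t fun m => if m = w then 1 else 0, ← Finset.card_filter,
    Finset.filter_filter]
  simp_rw [and_comm]

/-- Double counting of the zeros of the codewords of a given weight. -/
theorem sum_weightCount_shortened_singleton (C : Submodule F (ι → F)) (w : ℕ) :
    ∑ t, weightCount (shortened C {t}) w = (Fintype.card ι - w) * weightCount C w := by
  simp_rw [weightCount_shortened_singleton, ← Finset.filter_filter]
  rw [Finset.sum_congr rfl fun t _ => Finset.card_filter (fun c : ι → F => c t = 0) _,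
    Finset.sum_comm]
  rw [weightCount_eq_card, mul_comm, ← smul_eq_mul, ← Finset.sum_const]
  refine Finset.sum_congr rfl fun c hc => ?_
  rw [← Finset.card_filter, ← (Finset.mem_filter.1 hc).2]
  have := card_zeroSet_add_hammingNorm c
  rw [zeroSet] at this
  omega

end Deletion

end Codewords

/-! ### Small binomial coefficients as polynomials. -/

theorem two_mul_cast_choose_two (m : ℕ) : 2 * (m.choose 2 : ℤ) = m * (m - 1) := by
  induction m with
  | zero => simp
  | succ m ih =>
    rw [Nat.choose_succ_succ' m 1, Nat.choose_one_right]
    push_cast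
    linear_combination ih

theorem six_mul_cast_choose_three (m : ℕ) :
    6 * (m.choose 3 : ℤ) = m * (m - 1) * (m - 2) := by
  induction m with
  | zero => simp
  | succ m ih =>
    rw [Nat.choose_succ_succ' m 2]
    push_cast
    linear_combination ih + 3 * two_mul_cast_choose_two m

/-! ### The two weights of an ovoid code. -/

section Ovoid

variable {F : Type*} [Field F] [Fintype F] [DecidableEq F] {ι : Type*} [Fintype ι]
  {q : ℕ} {C : Submodule F (ι → F)}

omit [Fintype F] in
theorem HasParams.card_zeroSet_le (hC : HasParams C (q ^ 2 + 1) 4 (q ^ 2 - q))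
    {c : ι → F} (hc : c ∈ C) (h0 : c ≠ 0) : (zeroSet c).card ≤ q + 1 := by
  have h₁ := hC.minDist_eq.le_hammingNorm hc h0
  have h₂ := card_zeroSet_add_hammingNorm c
  have h₃ : q ≤ q ^ 2 := Nat.le_self_pow two_ne_zero q
  rw [hC.length_eq] at h₂
  omega

variable [DecidableEq ι]

/-- Any three coordinates impose independent conditions on `C`. -/
theorem HasParams.finrank_vanishingOn_of_card_eq_three
    (hC : HasParams C (q ^ 2 + 1) 4 (q ^ 2 - q)) (hF : Fintype.card F = q) (hq : 2 ≤ q)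
    {T : Finset ι} (hT : T.card = 3) : Module.finrank F (vanishingOn C T) = 1 := by
  have hge := finrank_le_card_add_finrank_vanishingOn C T
  rw [hC.dim_eq, hT] at hge
  by_contra hne
  have hd : 2 ≤ Module.finrank F (vanishingOn C T) := by omega
  set D := vanishingOn C T with hD
  set M := (codewords D).card with hM
  have hMq : q ^ 2 ≤ M := by
    rw [hM, card_codewords, hF]
    exact Nat.pow_le_pow_right (by omega) hd
  -- The zero word has `q ^ 2 + 1` zeros and each of the other `M - 1` words has at most `q + 1`.
  have hupper : ∑ c ∈ codewords D, (zeroSet c).card + (q + 1) ≤ q ^ 2 + 1 + M * (q + 1) := by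
    have h0 : (0 : ι → F) ∈ codewords D := mem_codewords.2 D.zero_mem
    have hz : (zeroSet (0 : ι → F)).card = q ^ 2 + 1 := by
      have := card_zeroSet_add_hammingNorm (0 : ι → F)
      rwa [hammingNorm_zero, hC.length_eq] at this
    rw [← Finset.add_sum_erase _ _ h0, hz, hM, ← Finset.card_erase_add_one h0]
    have := Finset.sum_le_card_nsmul ((codewords D).erase 0) (fun c => (zeroSet c).card) (q + 1)
      fun c hc => hC.card_zeroSet_le (mem_codewords.1 (Finset.mem_of_mem_erase hc)).1
        (Finset.ne_of_mem_erase hc)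
    rw [smul_eq_mul] at this
    linarith
  -- One more coordinate lowers the dimension by at most one.
  have hlow : ∀ i, M ≤ q * (codewords (vanishingOn D {i})).card := by
    intro i
    rw [hM, card_codewords, card_codewords, hF, ← pow_succ']
    refine Nat.pow_le_pow_right (by omega) ?_
    have := finrank_le_card_add_finrank_vanishingOn D {i}
    rw [Finset.card_singleton] at this
    omega
  have hmem : ∀ i ∈ T, (codewords (vanishingOn D {i})).card = M := by
    intro i hi
    rw [hD, vanishingOn_vanishingOn, Finset.union_eq_left.2 (by simpa using hi)]
  have hcompl : Tᶜ.card + 3 = q ^ 2 + 1 := by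
    rw [← hT, ← hC.length_eq, add_comm, Finset.card_add_card_compl]
  have hlower : 3 * (q * M) + Tᶜ.card * M ≤ q * ∑ c ∈ codewords D, (zeroSet c).card := by
    rw [sum_card_zeroSet, ← Finset.sum_add_sum_compl T, mul_add, Finset.sum_congr rfl hmem,
      Finset.sum_const, hT, Finset.mul_sum]
    refine add_le_add (by simp only [smul_eq_mul]; linarith) ?_
    rw [← smul_eq_mul, ← Finset.sum_const]
    exact Finset.sum_le_sum fun i _ => hlow i
  have h₁ := Nat.mul_le_mul_left q hupper
  zify at h₁ hlower hcompl hMq hq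
  have h₂ : (Tᶜ.card : ℤ) = q ^ 2 - 2 := by linarith
  rw [h₂] at hlower
  -- The two counts give `2 * M ≤ q ^ 2`, against `q ^ 2 ≤ M`.
  have h₃ : (M : ℤ) * 2 * (q - 1) ≤ q ^ 2 * (q - 1) := by linarith
  have h₄ := le_of_mul_le_mul_right h₃ (by linarith)
  nlinarith

/-- Enlarge `T` to a set `S` of three coordinates. Local duality shows that no nonzero dual word is
supported on `S`, hence none on `T`; local duality on `T` then gives the dimension. -/
theorem HasParams.card_add_finrank_vanishingOn
    (hC : HasParams C (q ^ 2 + 1) 4 (q ^ 2 - q)) (hF : Fintype.card F = q) (hq : 2 ≤ q)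
    {T : Finset ι} (hT : T.card ≤ 3) :
    T.card + Module.finrank F (vanishingOn C T) = 4 := by
  obtain ⟨S, hTS, hS⟩ := Finset.exists_superset_card_eq hT
    (by rw [hC.length_eq]; nlinarith)
  have h₁ := finrank_vanishingOn_dual_compl C S
  rw [hC.finrank_vanishingOn_of_card_eq_three hF hq hS, hC.dim_eq, hS] at h₁
  have h₂ := Submodule.finrank_mono
    (vanishingOn_anti (dual C) (Finset.compl_subset_compl.2 hTS))
  have h₃ := finrank_vanishingOn_dual_compl C T
  rw [hC.dim_eq] at h₃
  omega

theorem HasParams.card_codewords_vanishingOn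
    (hC : HasParams C (q ^ 2 + 1) 4 (q ^ 2 - q)) (hF : Fintype.card F = q) (hq : 2 ≤ q)
    {T : Finset ι} (hT : T.card ≤ 3) :
    (codewords (vanishingOn C T)).card = q ^ (4 - T.card) := by
  have := hC.card_add_finrank_vanishingOn hF hq hT
  rw [card_codewords, hF]
  congr 1
  omega

theorem HasParams.three_lt_hammingNorm_of_mem_dual
    (hC : HasParams C (q ^ 2 + 1) 4 (q ^ 2 - q)) (hF : Fintype.card F = q) (hq : 2 ≤ q)
    {d : ι → F} (hd : d ∈ dual C) (h0 : d ≠ 0) : 3 < hammingNorm d :=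
  lt_hammingNorm_of_mem_dual
    (fun _ hT => (hC.card_add_finrank_vanishingOn hF hq hT).trans hC.dim_eq.symm) hd h0

theorem HasParams.sum_card_zeroSet_choose
    (hC : HasParams C (q ^ 2 + 1) 4 (q ^ 2 - q)) (hF : Fintype.card F = q) (hq : 2 ≤ q)
    {j : ℕ} (hj : j ≤ 3) :
    ∑ c ∈ codewords C, (zeroSet c).card.choose j = (q ^ 2 + 1).choose j * q ^ (4 - j) := by
  rw [LinearCode.sum_card_zeroSet_choose, Finset.sum_congr rfl fun T hT => ?_, Finset.sum_const,
    Finset.card_powersetCard, Finset.card_univ, hC.length_eq, smul_eq_mul]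
  have hT := (Finset.mem_powersetCard.1 hT).2
  rw [hC.card_codewords_vanishingOn hF hq (hT.trans_le hj), hT]

/-- Every plane section of an ovoid has `1` or `q + 1` points. -/
theorem HasParams.card_zeroSet_eq
    (hC : HasParams C (q ^ 2 + 1) 4 (q ^ 2 - q)) (hF : Fintype.card F = q) (hq : 2 ≤ q)
    {c : ι → F} (hc : c ∈ C) (h0 : c ≠ 0) :
    (zeroSet c).card = 1 ∨ (zeroSet c).card = q + 1 := by
  -- A cubic in the number of zeros, so three factorial moments determine its sum. It is nonnegative
  -- up to `q + 1` and vanishes there only at `1` and `q + 1`.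
  set g : (ι → F) → ℤ := fun c => (q + 1 - (zeroSet c).card) * ((zeroSet c).card - 1) ^ 2 with hg
  have hexp : ∀ c : ι → F, g c = -6 * ((zeroSet c).card.choose 3 : ℤ)
      + 2 * q * ((zeroSet c).card.choose 2 : ℤ) - (q + 1) * ((zeroSet c).card.choose 1 : ℤ)
      + (q + 1) * ((zeroSet c).card.choose 0 : ℤ) := by
    intro c
    have h₂ := two_mul_cast_choose_two (zeroSet c).card
    have h₃ := six_mul_cast_choose_three (zeroSet c).card
    rw [Nat.choose_one_right, Nat.choose_zero_right]
    simp only [hg]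
    push_cast
    linear_combination h₃ - (q : ℤ) * h₂
  have hm : ∀ j ≤ 3, ∑ c ∈ codewords C, ((zeroSet c).card.choose j : ℤ) =
      ((q ^ 2 + 1).choose j : ℤ) * q ^ (4 - j) := fun j hj => by
    exact_mod_cast hC.sum_card_zeroSet_choose hF hq hj
  have hsum : ∑ c ∈ codewords C, g c = (q : ℤ) ^ 5 - q ^ 6 := by
    simp only [hexp, Finset.sum_add_distrib, Finset.sum_sub_distrib, ← Finset.mul_sum]
    rw [hm 0 (by omega), hm 1 (by omega), hm 2 (by omega), hm 3 (by omega), Nat.choose_one_right,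
      Nat.choose_zero_right]
    have h₂ := two_mul_cast_choose_two (q ^ 2 + 1)
    have h₃ := six_mul_cast_choose_three (q ^ 2 + 1)
    push_cast at h₂ h₃ ⊢
    linear_combination (-(q : ℤ)) * h₃ + (q : ℤ) ^ 3 * h₂
  -- The zero word alone accounts for the whole sum, so every other term must vanish.
  have hzero : g 0 = (q : ℤ) ^ 5 - q ^ 6 := by
    have := card_zeroSet_add_hammingNorm (0 : ι → F)
    rw [hammingNorm_zero, hC.length_eq, add_zero] at this
    simp only [hg, this]
    push_cast
    ring
  have herase : ∑ c ∈ (codewords C).erase 0, g c = 0 := by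
    have := Finset.add_sum_erase (codewords C) g (mem_codewords.2 C.zero_mem)
    linarith
  have hnonneg : ∀ c ∈ (codewords C).erase 0, 0 ≤ g c := by
    intro c hc
    have := hC.card_zeroSet_le (mem_codewords.1 (Finset.mem_of_mem_erase hc))
      (Finset.ne_of_mem_erase hc)
    refine mul_nonneg ?_ (sq_nonneg _)
    have : ((zeroSet c).card : ℤ) ≤ q + 1 := by exact_mod_cast this
    linarith
  have hgc := (Finset.sum_eq_zero_iff_of_nonneg hnonneg).1 herase c
    (Finset.mem_erase.2 ⟨h0, mem_codewords.2 hc⟩)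
  rcases mul_eq_zero.1 hgc with h | h
  · right
    zify
    linarith
  · left
    have := pow_eq_zero_iff two_ne_zero |>.1 h
    zify
    linarith

/-- The weight distribution of a set of nonzero words of an ovoid code is determined by its
cardinality and its total number of zeros. -/
theorem HasParams.exists_weight_distribution
    (hC : HasParams C (q ^ 2 + 1) 4 (q ^ 2 - q)) (hF : Fintype.card F = q) (hq : 2 ≤ q)
    {S : Finset (ι → F)} (hS : ∀ c ∈ S, c ∈ C ∧ c ≠ 0) :
    ∃ a b : ℤ, a + b = S.card ∧ a + (q + 1) * b = ∑ c ∈ S, (zeroSet c).card ∧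
      ∀ {R : Type*} [CommRing R] (f : ℕ → R),
        ∑ c ∈ S, f (hammingNorm c) = b * f (q ^ 2 - q) + a * f (q ^ 2) := by
  have h₀ : ∀ c ∈ S, ¬ (zeroSet c).card = 1 → (zeroSet c).card = q + 1 := fun c hc h =>
    (hC.card_zeroSet_eq hF hq (hS c hc).1 (hS c hc).2).resolve_left h
  refine ⟨(S.filter fun c => (zeroSet c).card = 1).card,
    (S.filter fun c => ¬ (zeroSet c).card = 1).card, ?_, ?_, ?_⟩
  · exact_mod_cast Finset.card_filter_add_card_filter_not _
  · rw [← Finset.sum_filter_add_sum_filter_not S fun c => (zeroSet c).card = 1,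
      Finset.sum_congr rfl fun c hc => (Finset.mem_filter.1 hc).2,
      Finset.sum_congr (s₁ := S.filter fun c => ¬ (zeroSet c).card = 1) rfl fun c hc =>
        h₀ c (Finset.mem_filter.1 hc).1 (Finset.mem_filter.1 hc).2]
    simp only [Finset.sum_const, smul_eq_mul]
    push_cast
    ring
  · intro R _ f
    rw [← Finset.sum_filter_add_sum_filter_not S fun c => (zeroSet c).card = 1,
      Finset.sum_congr rfl fun c hc => by
        rw [hammingNorm_eq_sub_card_zeroSet, (Finset.mem_filter.1 hc).2, hC.length_eq],
      Finset.sum_congr (s₁ := S.filter fun c => ¬ (zeroSet c).card = 1) rfl fun c hc => by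
        rw [hammingNorm_eq_sub_card_zeroSet,
          h₀ c (Finset.mem_filter.1 hc).1 (Finset.mem_filter.1 hc).2, hC.length_eq]]
    simp only [Finset.sum_const, nsmul_eq_mul, Nat.add_sub_add_right, Nat.add_sub_cancel]
    push_cast
    ring

theorem HasParams.card_filter_eq_zero
    (hC : HasParams C (q ^ 2 + 1) 4 (q ^ 2 - q)) (hF : Fintype.card F = q) (hq : 2 ≤ q)
    (t : ι) : ((codewords C).filter (· t = 0)).card = q ^ 3 := by
  rw [← codewords_vanishingOn_singleton, hC.card_codewords_vanishingOn hF hq (by simp)]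
  simp

/-- All `q ^ 3` words vanish at `t`, and each of the `q ^ 2` other coordinates is a zero of `q ^ 2`
of them. -/
theorem HasParams.sum_card_zeroSet_filter_eq_zero
    (hC : HasParams C (q ^ 2 + 1) 4 (q ^ 2 - q)) (hF : Fintype.card F = q) (hq : 2 ≤ q)
    (t : ι) : ∑ c ∈ codewords C with c t = 0, (zeroSet c).card = q ^ 3 + q ^ 4 := by
  rw [← codewords_vanishingOn_singleton, sum_card_zeroSet,
    ← Finset.add_sum_erase _ _ (Finset.mem_univ t), vanishingOn_vanishingOn, Finset.union_self,
    hC.card_codewords_vanishingOn hF hq (by simp), Finset.card_singleton,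
    Finset.sum_congr rfl fun i hi => ?_, Finset.sum_const, Finset.card_erase_of_mem
    (Finset.mem_univ t), Finset.card_univ, hC.length_eq, Nat.add_sub_cancel, smul_eq_mul,
    ← pow_add (a := q) 2 2]
  have hne : t ≠ i := (Finset.ne_of_mem_erase hi).symm
  have h2 : ({t} ∪ {i} : Finset ι).card = 2 := Finset.card_pair hne
  rw [vanishingOn_vanishingOn, hC.card_codewords_vanishingOn hF hq (by rw [h2]; omega), h2]

/-- The weight distribution of the words of an ovoid code that vanish at `t`. -/
theorem HasParams.sum_filter_eq_zero
    (hC : HasParams C (q ^ 2 + 1) 4 (q ^ 2 - q)) (hF : Fintype.card F = q) (hq : 2 ≤ q)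
    (t : ι) {R : Type*} [CommRing R] (f : ℕ → R) :
    ∑ c ∈ codewords C with c t = 0, f (hammingNorm c) =
      f 0 + q * (q ^ 2 - 1) * f (q ^ 2 - q) + (q - 1) * f (q ^ 2) := by
  have h0 : (0 : ι → F) ∈ (codewords C).filter (· t = 0) := by simp
  obtain ⟨a, b, h₁, h₂, h₃⟩ := hC.exists_weight_distribution hF hq
    (S := ((codewords C).filter (· t = 0)).erase 0) fun c hc => by
      simp only [Finset.mem_erase, Finset.mem_filter, mem_codewords] at hc
      exact ⟨hc.2.1, hc.1⟩
  have hcard := hC.card_filter_eq_zero hF hq t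
  have hsum := hC.sum_card_zeroSet_filter_eq_zero hF hq t
  have hz := card_zeroSet_add_hammingNorm (0 : ι → F)
  rw [hammingNorm_zero, hC.length_eq, add_zero] at hz
  rw [← Finset.card_erase_add_one h0] at hcard
  rw [← Finset.add_sum_erase _ _ h0, hz] at hsum
  rw [← Finset.add_sum_erase _ _ h0, h₃, hammingNorm_zero]
  zify at hcard hsum
  rw [← Nat.cast_sum] at hsum
  have hq0 : (q : ℤ) ≠ 0 := by exact_mod_cast (by omega : q ≠ 0)
  -- Subtracting the number of words from the number of zeros leaves `q * b`.
  have hb : b = q * (q ^ 2 - 1) := by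
    refine mul_left_cancel₀ hq0 ?_
    linarith
  have ha : a = q - 1 := by linarith
  rw [ha, hb]
  push_cast
  ring

/-- The weight distribution of the words of an ovoid code that do not vanish at `t`. -/
theorem HasParams.sum_filter_ne_zero
    (hC : HasParams C (q ^ 2 + 1) 4 (q ^ 2 - q)) (hF : Fintype.card F = q) (hq : 2 ≤ q)
    (t : ι) {R : Type*} [CommRing R] (f : ℕ → R) :
    ∑ c ∈ codewords C with c t ≠ 0, f (hammingNorm c) =
      q ^ 2 * (q - 1) ^ 2 * f (q ^ 2 - q) + q ^ 2 * (q - 1) * f (q ^ 2) := by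
  obtain ⟨a, b, h₁, h₂, h₃⟩ := hC.exists_weight_distribution hF hq
    (S := (codewords C).filter (· t ≠ 0)) fun c hc => by
      simp only [Finset.mem_filter, mem_codewords] at hc
      exact ⟨hc.1, fun h => hc.2 (congrFun h t)⟩
  have hcard := hC.card_filter_eq_zero hF hq t
  have hsum := hC.sum_card_zeroSet_filter_eq_zero hF hq t
  have hcard' := card_codewords C
  rw [hF, hC.dim_eq, ← Finset.card_filter_add_card_filter_not (· t = 0), hcard] at hcard'
  have hsum' := hC.sum_card_zeroSet_choose hF hq (j := 1) (by omega)
  simp only [Nat.choose_one_right] at hsum'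
  rw [← Finset.sum_filter_add_sum_filter_not _ (· t = 0), hsum] at hsum'
  rw [h₃]
  zify at hcard' hsum'
  rw [← Nat.cast_sum] at hsum'
  have hq0 : (q : ℤ) ≠ 0 := by exact_mod_cast (by omega : q ≠ 0)
  have hb : b = q ^ 2 * (q - 1) ^ 2 := by
    refine mul_left_cancel₀ hq0 ?_
    simp only [Nat.reduceSub] at hsum'
    linarith
  have ha : a = q ^ 2 * (q - 1) := by linarith
  rw [ha, hb]
  push_cast
  ring

end Ovoid

/-! ### Reading the minimum distance off weight sums. -/

section MinDist

variable {F : Type*} [Field F] [DecidableEq F] {ι : Type*} [Fintype ι]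

theorem IsMinDist.exists_hammingNorm_eq {C : Submodule F (ι → F)} {d : ℕ} (h : IsMinDist C d) :
    ∃ c ∈ C, c ≠ 0 ∧ hammingNorm c = d := by
  obtain ⟨⟨x, hx, y, hy, hxy, rfl⟩, -⟩ := h
  exact ⟨-x + y, C.add_mem (C.neg_mem hx) hy, fun h => hxy (neg_add_eq_zero.1 h),
    (hammingDist_eq_hammingNorm x y).symm⟩

theorem isMinDist_of_sum [Fintype F] {C : Submodule F (ι → F)} {d : ℕ} (hd : 0 < d)
    (h₀ : ∀ w, 0 < w → w < d →
      ∑ c ∈ codewords C, (if hammingNorm c = w then 1 else 0 : ℤ) = 0)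
    (h₁ : ∑ c ∈ codewords C, (if hammingNorm c = d then 1 else 0 : ℤ) ≠ 0) :
    IsMinDist C d := by
  refine isMinDist_of_forall_le (fun c hc h0 => ?_) ?_
  · by_contra! hlt
    have h := h₀ _ (hammingNorm_pos_iff.2 h0) hlt
    rw [Finset.sum_eq_zero_iff_of_nonneg fun _ _ => by positivity] at h
    simpa using h c (mem_codewords.2 hc)
  · obtain ⟨c, hc, h⟩ := Finset.exists_ne_zero_of_sum_ne_zero h₁
    have hcd : hammingNorm c = d := by
      by_contra hne
      exact h (if_neg hne)
    exact ⟨c, mem_codewords.1 hc, hammingNorm_pos_iff.1 (hcd ▸ hd), hcd.le⟩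

end MinDist

/-! ### Coefficients of the MacWilliams summands. -/

section Coefficients

theorem coeff_one_add_C_mul_X_pow (a : ℤ) (n k : ℕ) :
    ((1 + C a * X : ℤ[X]) ^ n).coeff k = n.choose k * a ^ k := by
  have h : (1 + C a * X : ℤ[X]) ^ n = ((1 + X) ^ n).comp (C a * X) := by simp
  rw [h, comp_C_mul_X_coeff, coeff_one_add_X_pow]

theorem coeff_one_sub_X_pow_mul (a : ℤ) (m n k : ℕ) :
    ((1 - X) ^ m * (1 + C a * X) ^ n : ℤ[X]).coeff k =
      ∑ p ∈ Finset.HasAntidiagonal.antidiagonal k,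
        (m.choose p.1 : ℤ) * (-1) ^ p.1 * ((n.choose p.2 : ℤ) * a ^ p.2) := by
  rw [show (1 - X : ℤ[X]) = 1 + C (-1) * X by simp [sub_eq_add_neg], coeff_mul]
  simp_rw [coeff_one_add_C_mul_X_pow]

theorem coeff_one_sub_X_pow_mul_one_add (a : ℤ) (m : ℕ) {k : ℕ} (hk : 1 ≤ k) :
    ((1 - X) ^ m * (1 + C a * X) : ℤ[X]).coeff k =
      (-1) ^ k * (m.choose k : ℤ) + (-1) ^ (k - 1) * a * (m.choose (k - 1) : ℤ) := by
  obtain ⟨k, rfl⟩ := Nat.exists_eq_add_of_le' hk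
  rw [show (1 - X : ℤ[X]) = 1 + C (-1) * X by simp [sub_eq_add_neg], mul_add, mul_one,
    ← mul_assoc, coeff_add, coeff_mul_X, coeff_mul_C, coeff_one_add_C_mul_X_pow,
    coeff_one_add_C_mul_X_pow, Nat.add_sub_cancel]
  ring

end Coefficients

/-! ### Shortened and punctured ovoid codes and their duals. -/

section OvoidDeletion

variable {F : Type*} [Field F] [Fintype F] [DecidableEq F] {ι : Type*} [Fintype ι]
  [DecidableEq ι] {q : ℕ} {C : Submodule F (ι → F)}

theorem HasParams.sum_codewords
    (hC : HasParams C (q ^ 2 + 1) 4 (q ^ 2 - q)) (hF : Fintype.card F = q) (hq : 2 ≤ q)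
    {R : Type*} [CommRing R] (f : ℕ → R) :
    ∑ c ∈ codewords C, f (hammingNorm c) =
      f 0 + (q ^ 2 - q) * (q ^ 2 + 1) * f (q ^ 2 - q) + (q - 1) * (q ^ 2 + 1) * f (q ^ 2) := by
  have : 0 < Fintype.card ι := by
    rw [hC.length_eq]
    omega
  obtain ⟨t⟩ := Fintype.card_pos_iff.1 this
  rw [← Finset.sum_filter_add_sum_filter_not _ fun c => c t = 0, hC.sum_filter_eq_zero hF hq,
    hC.sum_filter_ne_zero hF hq]
  ring

theorem HasParams.sum_codewords_shortened
    (hC : HasParams C (q ^ 2 + 1) 4 (q ^ 2 - q)) (hF : Fintype.card F = q) (hq : 2 ≤ q)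
    (t : ι) {R : Type*} [CommRing R] (f : ℕ → R) :
    ∑ c ∈ codewords (shortened C {t}), f (hammingNorm c) =
      f 0 + q * (q ^ 2 - 1) * f (q ^ 2 - q) + (q - 1) * f (q ^ 2) := by
  rw [sum_codewords_shortened_singleton, hC.sum_filter_eq_zero hF hq]

omit [Fintype F] in
theorem HasParams.restrict_injOn
    (hC : HasParams C (q ^ 2 + 1) 4 (q ^ 2 - q)) (hq : 3 ≤ q) (t : ι) :
    Set.InjOn (fun (c : ι → F) (i : {i // i ∉ ({t} : Finset ι)}) => c i)
      (C : Set (ι → F)) := by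
  intro c hc d hd hcd
  by_contra hne
  -- Words that agree off `t` differ by a word of weight at most 1, below the minimum distance.
  have h₁ := hC.minDist_eq.le_hammingNorm (C.sub_mem hc hd) (sub_ne_zero.2 hne)
  have h₂ := hammingNorm_restrict_singleton (c - d) t
  have h₃ : (fun i : {i // i ∉ ({t} : Finset ι)} => (c - d) i) = 0 :=
    funext fun i => sub_eq_zero.2 (congrFun hcd i)
  rw [h₃, hammingNorm_zero] at h₂
  have h₄ : q + 2 ≤ q ^ 2 := by nlinarith
  split_ifs at h₂ <;> omega

theorem HasParams.sum_codewords_punctured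
    (hC : HasParams C (q ^ 2 + 1) 4 (q ^ 2 - q)) (hF : Fintype.card F = q) (hq : 3 ≤ q)
    (t : ι) {R : Type*} [CommRing R] (f : ℕ → R) :
    ∑ c ∈ codewords (punctured C {t}), f (hammingNorm c) =
      f 0 + q ^ 2 * (q - 1) ^ 2 * f (q ^ 2 - q - 1) + q * (q ^ 2 - 1) * f (q ^ 2 - q)
        + q ^ 2 * (q - 1) * f (q ^ 2 - 1) + (q - 1) * f (q ^ 2) := by
  rw [sum_codewords_punctured_singleton (hC.restrict_injOn hq t),
    hC.sum_filter_eq_zero hF (by omega),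
    hC.sum_filter_ne_zero hF (by omega) t fun w => f (w - 1)]
  ring

omit [Fintype F] in
theorem HasParams.card_subtype
    (hC : HasParams C (q ^ 2 + 1) 4 (q ^ 2 - q)) (t : ι) :
    Fintype.card {i // i ∉ ({t} : Finset ι)} = q ^ 2 := by
  have := card_subtype_notMem_singleton t
  rw [hC.length_eq] at this
  omega

theorem HasParams.shortened_singleton
    (hC : HasParams C (q ^ 2 + 1) 4 (q ^ 2 - q)) (hF : Fintype.card F = q) (hq : 2 ≤ q)
    (t : ι) : HasParams (shortened C {t}) (q ^ 2) 3 (q ^ 2 - q) := by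
  have hlt : q < q ^ 2 := by nlinarith
  have hqz : (2 : ℤ) ≤ q := by exact_mod_cast hq
  refine ⟨hC.card_subtype t, ?_, isMinDist_of_sum (by omega) ?_ ?_⟩
  · have := hC.card_add_finrank_vanishingOn hF hq (T := {t}) (by simp)
    rw [finrank_shortened]
    rw [Finset.card_singleton] at this
    omega
  · intro w h0 hw
    rw [hC.sum_codewords_shortened hF hq t fun m => if m = w then (1 : ℤ) else 0, if_neg (by omega),
      if_neg (by omega), if_neg (by omega)]
    ring
  · rw [hC.sum_codewords_shortened hF hq t fun m => if m = q ^ 2 - q then (1 : ℤ) else 0,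
      if_neg (by omega), if_pos rfl, if_neg (by omega)]
    have : 0 < (q : ℤ) * (q ^ 2 - 1) := mul_pos (by linarith) (by nlinarith)
    linarith

theorem HasParams.punctured_singleton
    (hC : HasParams C (q ^ 2 + 1) 4 (q ^ 2 - q)) (hF : Fintype.card F = q) (hq : 3 ≤ q)
    (t : ι) : HasParams (punctured C {t}) (q ^ 2) 4 (q ^ 2 - q - 1) := by
  have hlt : q + 2 ≤ q ^ 2 := by nlinarith
  have hqz : (3 : ℤ) ≤ q := by exact_mod_cast hq
  refine ⟨hC.card_subtype t, ?_, isMinDist_of_sum (by omega) ?_ ?_⟩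
  · rw [finrank_punctured (hC.restrict_injOn hq t), hC.dim_eq]
  · intro w h0 hw
    rw [hC.sum_codewords_punctured hF hq t fun m => if m = w then (1 : ℤ) else 0, if_neg (by omega),
      if_neg (by omega), if_neg (by omega), if_neg (by omega), if_neg (by omega)]
    ring
  · rw [hC.sum_codewords_punctured hF hq t fun m => if m = q ^ 2 - q - 1 then (1 : ℤ) else 0,
      if_neg (by omega), if_pos rfl, if_neg (by omega), if_neg (by omega), if_neg (by omega)]
    have : 0 < (q : ℤ) ^ 2 * (q - 1) ^ 2 := mul_pos (by positivity) (pow_pos (by linarith) 2)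
    linarith

/-- This dual is `dual C` punctured, and puncturing lowers the weight bound 4 by at most one.
Equality holds because a minimum weight word of the shortened code has `q` zeros, at least its
dimension 3. -/
theorem HasParams.dual_shortened_singleton
    (hC : HasParams C (q ^ 2 + 1) 4 (q ^ 2 - q)) (hF : Fintype.card F = q) (hq : 3 ≤ q)
    (t : ι) : HasParams (dual (shortened C {t})) (q ^ 2) (q ^ 2 - 3) 3 := by
  have hS := hC.shortened_singleton hF (by omega) t
  refine ⟨hS.length_eq, by rw [finrank_dual, hS.length_eq, hS.dim_eq],
    isMinDist_of_forall_le (fun x hx h0 => ?_) ?_⟩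
  · have hdual : dual (shortened C {t}) = punctured (dual C) {t} := by
      rw [← dual_shortened_dual, dual_dual]
    rw [hdual] at hx
    obtain ⟨d, hd, rfl⟩ := hx
    have hd0 : d ≠ 0 := by
      rintro rfl
      exact h0 (map_zero _)
    have h₁ := hC.three_lt_hammingNorm_of_mem_dual hF (by omega) hd hd0
    have h₂ := hammingNorm_restrict_singleton d t
    change 3 ≤ hammingNorm fun i : {i // i ∉ ({t} : Finset ι)} => d i
    split_ifs at h₂ <;> omega
  · obtain ⟨c, hc, h0, hw⟩ := hS.minDist_eq.exists_hammingNorm_eq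
    refine exists_dual_hammingNorm_le hS.dim_eq.le hc h0 ?_
    have h₁ := card_zeroSet_add_hammingNorm c
    have h₂ : q ≤ q ^ 2 := Nat.le_self_pow two_ne_zero q
    rw [hS.length_eq] at h₁
    omega

/-- Shortening keeps the weight bound 4. It is attained because a minimum weight word of the
punctured code has `q + 1` zeros, at least its dimension 4. -/
theorem HasParams.shortened_dual_singleton
    (hC : HasParams C (q ^ 2 + 1) 4 (q ^ 2 - q)) (hF : Fintype.card F = q) (hq : 3 ≤ q)
    (t : ι) : HasParams (shortened (dual C) {t}) (q ^ 2) (q ^ 2 - 4) 4 := by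
  have hP := hC.punctured_singleton hF hq t
  refine ⟨hP.length_eq, by rw [shortened_dual, finrank_dual, hP.length_eq, hP.dim_eq],
    isMinDist_of_forall_le ?_ ?_⟩
  · rintro _ ⟨d, ⟨hd, hdt⟩, rfl⟩ h0
    have hd0 : d ≠ 0 := by
      rintro rfl
      exact h0 (map_zero _)
    have h₁ := hC.three_lt_hammingNorm_of_mem_dual hF (by omega) hd hd0
    have h₂ := hammingNorm_restrict_singleton d t
    rw [if_pos (hdt t (Finset.mem_singleton_self t))] at h₂
    change 4 ≤ hammingNorm fun i : {i // i ∉ ({t} : Finset ι)} => d i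
    omega
  · obtain ⟨c, hc, h0, hw⟩ := hP.minDist_eq.exists_hammingNorm_eq
    rw [shortened_dual]
    refine exists_dual_hammingNorm_le hP.dim_eq.le hc h0 ?_
    have h₁ := card_zeroSet_add_hammingNorm c
    have h₂ : q + 2 ≤ q ^ 2 := by nlinarith
    rw [hP.length_eq] at h₁
    omega

/-- The `1`-design property of the dual of an ovoid code: the weight distribution of its shortened
code does not depend on the coordinate. -/
theorem HasParams.weightCount_shortened_dual_eq
    (hC : HasParams C (q ^ 2 + 1) 4 (q ^ 2 - q)) (hF : Fintype.card F = q) (hq : 3 ≤ q)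
    (s t : ι) (k : ℕ) :
    weightCount (shortened (dual C) {s}) k = weightCount (shortened (dual C) {t}) k := by
  -- `P` is the MacWilliams transform of the punctured code at `r`; its weight distribution does not
  -- involve `r`.
  obtain ⟨P, key⟩ : ∃ P : ℤ[X], ∀ r : ι,
      (q : ℤ[X]) ^ 4 * weightEnumerator (shortened (dual C) {r}) = P := by
    let f : ℕ → ℤ[X] := fun w => (1 - X) ^ w * (1 + ((q : ℤ[X]) - 1) * X) ^ (q ^ 2 - w)
    refine ⟨f 0 + q ^ 2 * (q - 1) ^ 2 * f (q ^ 2 - q - 1) + q * (q ^ 2 - 1) * f (q ^ 2 - q)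
      + q ^ 2 * (q - 1) * f (q ^ 2 - 1) + (q - 1) * f (q ^ 2), fun r => ?_⟩
    have hP := hC.punctured_singleton hF hq r
    have h := card_pow_finrank_mul_weightEnumerator_dual (punctured C {r})
    rw [hP.dim_eq, hP.length_eq, hF] at h
    rw [shortened_dual, h]
    exact hC.sum_codewords_punctured hF hq r f
  have hq0 : (q : ℤ[X]) ^ 4 ≠ 0 := pow_ne_zero 4 (Nat.cast_ne_zero.2 (by omega))
  have h := congrArg (coeff · k) (mul_left_cancel₀ hq0 ((key s).trans (key t).symm))
  simpa [coeff_weightEnumerator] using h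

theorem HasParams.mul_weightCount_shortened_dual
    (hC : HasParams C (q ^ 2 + 1) 4 (q ^ 2 - q)) (hF : Fintype.card F = q) (hq : 3 ≤ q)
    (t : ι) (k : ℕ) :
    (q ^ 2 + 1) * weightCount (shortened (dual C) {t}) k =
      (q ^ 2 + 1 - k) * weightCount (dual C) k := by
  rw [← hC.length_eq, ← sum_weightCount_shortened_singleton,
    Finset.sum_congr rfl fun s _ => hC.weightCount_shortened_dual_eq hF hq s t k]
  simp

/-- The three terms come from the weights `0`, `q ^ 2 - q` and `q ^ 2`, that is, from words with `q
^ 2 + 1`, `q + 1` and `1` zeros. -/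
theorem HasParams.pow_four_mul_weightCount_dual
    (hC : HasParams C (q ^ 2 + 1) 4 (q ^ 2 - q)) (hF : Fintype.card F = q) (hq : 2 ≤ q)
    {k : ℕ} (hk : 1 ≤ k) :
    (q : ℤ) ^ 4 * (weightCount (dual C) k : ℤ) =
      ((q ^ 2 + 1).choose k : ℤ) * ((q : ℤ) - 1) ^ k
      + (((q : ℤ) ^ 2 - q) * ((q : ℤ) ^ 2 + 1)) *
          ∑ p ∈ Finset.HasAntidiagonal.antidiagonal k,
            ((q ^ 2 - q).choose p.1 : ℤ) * (-1) ^ p.1 *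
              (((q + 1).choose p.2 : ℤ) * ((q : ℤ) - 1) ^ p.2)
      + (((q : ℤ) - 1) * ((q : ℤ) ^ 2 + 1)) *
          ((-1) ^ k * ((q ^ 2).choose k : ℤ)
            + (-1) ^ (k - 1) * ((q : ℤ) - 1) * ((q ^ 2).choose (k - 1) : ℤ)) := by
  have h := card_pow_finrank_mul_weightEnumerator_dual C
  have hle : q ≤ q ^ 2 := Nat.le_self_pow two_ne_zero q
  rw [hC.dim_eq, hC.length_eq, hF,
    hC.sum_codewords hF hq fun w =>
      (1 - X : ℤ[X]) ^ w * (1 + ((q : ℤ[X]) - 1) * X) ^ (q ^ 2 + 1 - w),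
    pow_zero, one_mul, Nat.sub_zero, show q ^ 2 + 1 - (q ^ 2 - q) = q + 1 by omega,
    Nat.add_sub_cancel_left, pow_one] at h
  have hu : ((q : ℤ[X]) ^ 2 - (q : ℤ[X])) * ((q : ℤ[X]) ^ 2 + 1) =
      Polynomial.C (((q : ℤ) ^ 2 - q) * ((q : ℤ) ^ 2 + 1)) := by simp
  have hv : ((q : ℤ[X]) - 1) * ((q : ℤ[X]) ^ 2 + 1) =
      Polynomial.C (((q : ℤ) - 1) * ((q : ℤ) ^ 2 + 1)) := by simp
  have hw : ((q : ℤ[X]) - 1) = Polynomial.C ((q : ℤ) - 1) := by simp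
  have hp : (q : ℤ[X]) ^ 4 = Polynomial.C ((q : ℤ) ^ 4) := by simp
  rw [hu, hv, hw, hp] at h
  have hk' := congrArg (coeff · k) h
  simp only [coeff_add, coeff_C_mul, coeff_weightEnumerator] at hk'
  rwa [coeff_one_add_C_mul_X_pow, coeff_one_sub_X_pow_mul,
    coeff_one_sub_X_pow_mul_one_add _ _ hk] at hk'

end OvoidDeletion

end LinearCode
-- Assembly of the four statements.
theorem mainTheorem5 {F : Type*} [Field F] [Fintype F] [DecidableEq F]
    {ι : Type*} [Fintype ι] [DecidableEq ι] (q : ℕ) (hF : Fintype.card F = q) (hq : 4 ≤ q)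
    (C : Submodule F (ι → F)) (hC : LinearCode.HasParams C (q ^ 2 + 1) 4 (q ^ 2 - q))
    (t₁ : ι) :
    -- the shortened code of `C`
    (LinearCode.HasParams (LinearCode.shortened C {t₁}) (q ^ 2) 3 (q ^ 2 - q) ∧
      LinearCode.weightEnumerator (LinearCode.shortened C {t₁}) =
        1 + (q : ℤ[X]) * ((q : ℤ[X]) ^ 2 - 1) * X ^ (q ^ 2 - q)
          + ((q : ℤ[X]) - 1) * X ^ (q ^ 2)) ∧
    -- its dual
    (LinearCode.HasParams (LinearCode.dual (LinearCode.shortened C {t₁}))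
        (q ^ 2) (q ^ 2 - 3) 3 ∧
      LinearCode.IsAlmostMDS (LinearCode.dual (LinearCode.shortened C {t₁}))) ∧
    -- the dual of the shortened code of the dual of `C`
    (LinearCode.HasParams (LinearCode.dual (LinearCode.shortened (LinearCode.dual C) {t₁}))
        (q ^ 2) 4 (q ^ 2 - q - 1) ∧
      LinearCode.weightEnumerator
          (LinearCode.dual (LinearCode.shortened (LinearCode.dual C) {t₁})) =
        1 + (q : ℤ[X]) ^ 2 * ((q : ℤ[X]) - 1) ^ 2 * X ^ (q ^ 2 - q - 1)
          + (q : ℤ[X]) * ((q : ℤ[X]) ^ 2 - 1) * X ^ (q ^ 2 - q)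
          + (q : ℤ[X]) ^ 2 * ((q : ℤ[X]) - 1) * X ^ (q ^ 2 - 1)
          + ((q : ℤ[X]) - 1) * X ^ (q ^ 2)) ∧
    -- the shortened code of the dual of `C`
    (LinearCode.HasParams (LinearCode.shortened (LinearCode.dual C) {t₁})
        (q ^ 2) (q ^ 2 - 4) 4 ∧
      LinearCode.IsAlmostMDS (LinearCode.shortened (LinearCode.dual C) {t₁}) ∧
      (∀ k : ℕ, 1 ≤ k → k ≤ q ^ 2 →
        (LinearCode.weightCount (LinearCode.shortened (LinearCode.dual C) {t₁}) k : ℚ) =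
          ((k.choose 1 : ℚ) * ((q ^ 2).choose k : ℚ)) /
              (((q ^ 2 + 1).choose 1 : ℚ) * ((q ^ 2).choose (k - 1) : ℚ)) *
            (LinearCode.weightCount (LinearCode.dual C) k : ℚ)) ∧
      -- the weight distribution of the dual of `C` that enters this formula
      (∀ k : ℕ, 1 ≤ k → k ≤ 3 → LinearCode.weightCount (LinearCode.dual C) k = 0) ∧
      (∀ k : ℕ, 4 ≤ k → k ≤ q ^ 2 →
        (q : ℤ) ^ 4 * (LinearCode.weightCount (LinearCode.dual C) k : ℤ) =
          ((q ^ 2 + 1).choose k : ℤ) * ((q : ℤ) - 1) ^ k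
          + (((q : ℤ) ^ 2 - q) * ((q : ℤ) ^ 2 + 1)) *
              ∑ p ∈ Finset.HasAntidiagonal.antidiagonal k,
                ((q ^ 2 - q).choose p.1 : ℤ) * (-1) ^ p.1 *
                  (((q + 1).choose p.2 : ℤ) * ((q : ℤ) - 1) ^ p.2)
          + (((q : ℤ) - 1) * ((q : ℤ) ^ 2 + 1)) *
              ((-1) ^ k * ((q ^ 2).choose k : ℤ)
                + (-1) ^ (k - 1) * ((q : ℤ) - 1) * ((q ^ 2).choose (k - 1) : ℤ)))) := by
  have hq2 : 2 ≤ q := by omega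
  have hq3 : 3 ≤ q := by omega
  -- Ensures that `q ^ 2 - 3` and `q ^ 2 - 4` are not truncated in the almost MDS equations.
  have hle : 4 * q ≤ q ^ 2 := by nlinarith
  have hdS := hC.dual_shortened_singleton hF hq3 t₁
  have hSd := hC.shortened_dual_singleton hF hq3 t₁
  refine ⟨⟨hC.shortened_singleton hF hq2 t₁, ?_⟩,
    ⟨hdS, _, _, _, hdS, by omega⟩, ⟨?_, ?_⟩, hSd, ⟨_, _, _, hSd, by omega⟩, ?_, ?_, ?_⟩
  · rw [LinearCode.weightEnumerator_eq_sum,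
      hC.sum_codewords_shortened hF hq2 t₁ fun w => (X : ℤ[X]) ^ w, pow_zero]
  · rw [LinearCode.dual_shortened_dual]
    exact hC.punctured_singleton hF hq3 t₁
  · rw [LinearCode.dual_shortened_dual, LinearCode.weightEnumerator_eq_sum,
      hC.sum_codewords_punctured hF hq3 t₁ fun w => (X : ℤ[X]) ^ w, pow_zero]
  · intro k hk hkq
    have h₁ := hC.mul_weightCount_shortened_dual hF hq3 t₁ k
    -- This turns the factor `q ^ 2 + 1 - k` from the double count into the quotient of binomial
    -- coefficients.
    have h₂ : (q ^ 2).choose k * k = (q ^ 2).choose (k - 1) * (q ^ 2 + 1 - k) := by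
      have := Nat.choose_succ_right_eq (q ^ 2) (k - 1)
      rwa [Nat.sub_add_cancel hk, show q ^ 2 - (k - 1) = q ^ 2 + 1 - k by omega] at this
    have h₃ : ((q ^ 2).choose (k - 1) : ℚ) ≠ 0 :=
      Nat.cast_ne_zero.2 (Nat.choose_pos (by omega)).ne'
    have h₄ : ((q : ℚ) ^ 2 + 1) ≠ 0 := by positivity
    rw [Nat.choose_one_right, Nat.choose_one_right, mul_comm (k : ℚ)]
    have h₁' := congrArg (Nat.cast : ℕ → ℚ) h₁
    have h₂' := congrArg (Nat.cast : ℕ → ℚ) h₂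
    push_cast at h₁' h₂' ⊢
    rw [h₂']
    field_simp
    linarith
  · intro k hk hk3
    rw [LinearCode.weightCount_eq_card, Finset.card_eq_zero, Finset.filter_eq_empty_iff]
    intro d hd hdk
    have := hC.three_lt_hammingNorm_of_mem_dual hF hq2 (LinearCode.mem_codewords.1 hd)
      (hammingNorm_pos_iff.1 (by omega))
    omega
  · exact fun k hk _ => hC.pow_four_mul_weightCount_dual hF hq2 (by omega)
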